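/- **Lemma (Soundness).** If the completion rules can be applied to an $\mathcal{ALCQPIH}_{R^+}$-concept $D$ in negation normal form so as to yield a complete and clash-free completion tree with respect to a role hierarchy $\mathcal R^+$, then $D$ has a tableau with respect to $\mathcal R^+$. This holds for every choice of the natural numbers $BAN_x$ (the border amount of neighbours of a node $x$ of a completion tree) used in the part rules. *Roles.* Let $\mathbf C_o,\mathbf R_o$ be nonempty sets of concept names and role names, $\mathbf R^+\subseteq\mathbf R_o$ the transitive role names, and $\mathbf Q_0\subseteq\mathbb Q\cap(0,1)$. Roles are $R$ and $R^-$ for $R\in\mathbf R_o$, with $\mathsf{Inv}(R)=R^-$, $\mathsf{Inv}(R^-)=R$; $\mathsf{Trans}(R)$ means that $R$ or $\mathsf{Inv}(R)$ is in $\mathbf R^+$. For a set $\mathcal R$ of role inclusions, $\sqsubseteq^+$ is the reflexive transitive closure of $\mathcal R\cup\{\mathsf{Inv}(R)\sqsubseteq\mathsf{Inv}(S): R\sqsubseteq S\in\mathcal R\}$. A role is simple if no $S\sqsubseteq^+R$ satisfies $\mathsf{Trans}(S)$. *Concepts.* They are built from concept names by $\neg C$, $C\sqcap D$, $C\sqcup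 D$, $\forall R.C$, $\exists R.C$, and, for simple $R$, $n\ge0$, $r\in\mathbf Q_0$, by ${\geqslant}nR.C$, ${\leqslant}nR.C$, $MrR.C$, $WrR.C$. In negation normal form (NNF) $\neg$ stands only before concept names; ${\sim}C$ is the NNF of $\neg C$, where ${\sim}MrR.C=WrR.{\sim}C$, ${\sim}WrR.C=MrR.{\sim}C$, and ${\sim}({\geqslant}0R.C)$ is the contradiction $C\sqcap{\sim}C$. $\mathbf R_D$ is the set of roles occurring in $D$ and their inverses, and $clos(D)$ is the smallest set containing $D$ and closed under sub-concepts and $\sim$. Let $clos^+(D)=clos(D)\cup\{\forall R.C:\ \forall S.C\in clos(D),\ \mathsf{Trans}(R),\ R\sqsubseteq^+S \text{ for some } S\}$. Below, $\boxtimes$ is any of $\exists,{\geqslant}n,{\leqslant}n,Mr,Wr$. *Tableaux.* A tableau for $D$ is a triple $(\mathbf S,\mathcal L,\mathcal E)$ with $\mathcal L:\mathbf S\to 2^{clos^+(D)}$, $\mathcal E:\mathbf R_D\to2^{\mathbf S\times\mathbf S}$, $D\in\mathcal L(s)$ for some $s$, and all sets $R^T(s)=\{t:\langle s,t\rangle\in\mathcal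 E(R)\}$ finite, such that for all $s,t\in\mathbf S$, $R,S\in\mathbf R_D$, with $R^T(s,C)=\{t\in R^T(s):C\in\mathcal L(t)\}$: 1. if $C\in\mathcal L(s)$ then $\neg C\notin\mathcal L(s)$; 2. if $C_1\sqcap C_2\in\mathcal L(s)$ then $C_1,C_2\in\mathcal L(s)$; 3. if $C_1\sqcup C_2\in\mathcal L(s)$ then $C_1\in\mathcal L(s)$ or $C_2\in\mathcal L(s)$; 4. if $\forall R.C\in\mathcal L(s)$ and $\langle s,t\rangle\in\mathcal E(R)$ then $C\in\mathcal L(t)$; 5. if $\exists R.C\in\mathcal L(s)$ then $\langle s,t\rangle\in\mathcal E(R)$ and $C\in\mathcal L(t)$ for some $t$; 6. if $\forall S.C\in\mathcal L(s)$, $\langle s,t\rangle\in\mathcal E(R)$, $R\sqsubseteq^+S$ and $\mathsf{Trans}(R)$, then $\forall R.C\in\mathcal L(t)$; 7. $\langle s,t\rangle\in\mathcal E(R)$ iff $\langle t,s\rangle\in\mathcal E(\mathsf{Inv}(R))$; 8. if $\langle s,t\rangle\in\mathcal E(R)$ and $R\sqsubseteq^+S$ then $\langle s,t\rangle\in\mathcal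 E(S)$; 9. if ${\leqslant}nR.C\in\mathcal L(s)$ then $\sharp R^T(s,C)\le n$; 10. if ${\geqslant}nR.C\in\mathcal L(s)$ then $\sharp R^T(s,C)\ge n$; 11. if $MrR.C\in\mathcal L(s)$ then $\sharp R^T(s,C)>r\cdot\sharp R^T(s)$; 12. if $WrR.C\in\mathcal L(s)$ then $\sharp R^T(s,{\sim}C)\le r\cdot\sharp R^T(s)$; 13. if $\boxtimes R.C\in\mathcal L(s)$ and $\langle s,t\rangle\in\mathcal E(R)$ then $C\in\mathcal L(t)$ or ${\sim}C\in\mathcal L(t)$. *Completion trees.* A completion tree is a finite rooted tree $\mathbf T$ with each node $x$ labelled by a set $\mathcal L(x)$ of concepts and each edge by a set $\mathcal L(\langle x,y\rangle)$ of roles. The initial tree is a single root labelled $\{D\}$. A successor $y$ of $x$ is an $R$-successor if some $S\in\mathcal L(\langle x,y\rangle)$ has $S\sqsubseteq^+R$; $y$ is an $R$-neighbour of $x$ if $y$ is an $R$-successor of $x$ or $x$ is an $\mathsf{Inv}(R)$-successor of $y$; $R^{\mathbf T}(x)$ is the set of $R$-neighbours of $x$ and $R^{\mathbf T}(x,C)$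 the set of those with $C$ in their label. If $z$ is the predecessor of $x$, then $\mathcal L(\langle x,z\rangle)$ means $\{\mathsf{Inv}(S):S\in\mathcal L(\langle z,x\rangle)\}$. *Blocking.* A node $x$ is directly blocked (by $y$) if none of its ancestors is blocked and it has ancestors $x',y,y'$ such that $x$ is a successor of $x'$, $y$ a successor of $y'$, $\mathcal L(x)=\mathcal L(y)$, $\mathcal L(x')=\mathcal L(y')$ and $\mathcal L(\langle x',x\rangle)=\mathcal L(\langle y',y\rangle)$. It is indirectly blocked if its predecessor is blocked or the edge leading to it has the label $\emptyset$. Blocked means directly or indirectly blocked. *Non-generating rules*, for a node $x$ that is not indirectly blocked: - $\sqcap$: if $C_1\sqcap C_2\in\mathcal L(x)$ and $\{C_1,C_2\}\not\subseteq\mathcal L(x)$, add $C_1,C_2$ to $\mathcal L(x)$. - $\sqcup$: if $C_1\sqcup C_2\in\mathcal L(x)$ and $\{C_1,C_2\}\cap\mathcal L(x)=\emptyset$, add $C_1$ or $C_2$ to $\mathcal L(x)$. - $\forall$: if $\forall R.C\in\mathcal L(x)$ and $y$ is an $R$-neighbour of $x$ with $C\notin\mathcal L(y)$, add $C$ to $\mathcal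 L(y)$. - $\forall_+$: if $\forall S.C\in\mathcal L(x)$, $\mathsf{Trans}(R)$, $R\sqsubseteq^+S$ and $y$ is an $R$-neighbour of $x$ with $\forall R.C\notin\mathcal L(y)$, add $\forall R.C$ to $\mathcal L(y)$. - choose: if $\boxtimes R.C\in\mathcal L(x)$ and $y$ is an $R$-neighbour of $x$ with $\{C,{\sim}C\}\cap\mathcal L(y)=\emptyset$, add $C$ or ${\sim}C$ to $\mathcal L(y)$. - $\leqslant$: if ${\leqslant}nR.C\in\mathcal L(x)$, $\sharp R^{\mathbf T}(x,C)>n$, and $y\ne z$ are in $R^{\mathbf T}(x,C)$ with $\mathcal L(\langle x,y\rangle)\cap\mathcal L(\langle x,z\rangle)=\emptyset$ and $y$ not the predecessor of $x$, then add $\mathcal L(y)$ to $\mathcal L(z)$; add $\{\mathsf{Inv}(S):S\in\mathcal L(\langle x,y\rangle)\}$ to $\mathcal L(\langle z,x\rangle)$ if $z$ is the predecessor of $x$, and add $\mathcal L(\langle x,y\rangle)$ to $\mathcal L(\langle x,z\rangle)$ otherwise; and set $\mathcal L(\langle x,y\rangle)=\emptyset$. *Generating rules*, for a node $x$ that is not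 blocked; each creates a new successor $y$ of $x$ with $\mathcal L(\langle x,y\rangle)=\{R\}$ and $\mathcal L(y)=\{C\}$: - $\exists$: if $\exists R.C\in\mathcal L(x)$ and $R^{\mathbf T}(x,C)=\emptyset$. - $\geqslant$: if ${\geqslant}nR.C\in\mathcal L(x)$ and $\sharp R^{\mathbf T}(x,C)<n$. - $M$: if $MrR.C\in\mathcal L(x)$, $\sharp R^{\mathbf T}(x,C)\le r\cdot\sharp R^{\mathbf T}(x)$ and $\sharp R^{\mathbf T}(x)<BAN_x$. - $W$: if $WrR.C\in\mathcal L(x)$, $\sharp R^{\mathbf T}(x,{\sim}C)>r\cdot\sharp R^{\mathbf T}(x)$ and $\sharp R^{\mathbf T}(x)<BAN_x$. Starting from the initial tree, the rules are applied one at a time in any order and with any of the choices allowed above, but a generating rule only when no non-generating rule is applicable. *Clashes.* $\mathbf T$ contains a clash if for some node $x$: (CL1) $\{C,\neg C\}\subseteq\mathcal L(x)$; (CL2) ${\leqslant}nR.C\in\mathcal L(x)$ and $\sharp R^{\mathbf T}(x,C)>n$; (CL3) $MrR.C\in\mathcal L(x)$ and $\sharp R^{\mathbf T}(x,C)\le r\cdot\sharp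 R^{\mathbf T}(x)$; or (CL4) $WrR.C\in\mathcal L(x)$ and $\sharp R^{\mathbf T}(x,{\sim}C)>r\cdot\sharp R^{\mathbf T}(x)$. Otherwise it is clash-free. $\mathbf T$ is complete if no rule is applicable or some node has a clash CL1 or CL2. -/

import Mathlib

namespace ALCQPIH

/-! ### Roles and role hierarchies -/

/-- Roles over the role names `NR`: a role name or the inverse of a role name. -/
inductive Role (NR : Type*) where
  | name : NR → Role NR
  | inverse : NR → Role NR

/-- The function `Inv` on roles. -/
def Role.inv {NR : Type*} : Role NR → Role NR
  | .name a => .inverse a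
  | .inverse a => .name a

/-- The role name underlying a role. -/
def Role.base {NR : Type*} : Role NR → NR
  | .name a => a
  | .inverse a => a

/-- The transitive role names together with a set of role inclusion axioms
(`(R, S) ∈ incl` stands for `R ⊑ S`). -/
structure RBox (NR : Type*) where
  transNames : Set NR
  incl : Set (Role NR × Role NR)

namespace RBox

variable {NR : Type*}

/-- One inclusion of the role hierarchy: `R ⊑ S` is given, or it is
`Inv(R') ⊑ Inv(S')` for a given `R' ⊑ S'`. -/
def Base (H : RBox NR) (R S : Role NR) : Prop :=
  (R, S) ∈ H.incl ∨ ∃ R' S' : Role NR, (R', S') ∈ H.incl ∧ R = R'.inv ∧ S = S'.inv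

/-- `R ⊑⁺ S`: the reflexive and transitive closure. -/
def Sub (H : RBox NR) (R S : Role NR) : Prop :=
  Relation.ReflTransGen H.Base R S

/-- `Trans(R)`: `R` or `Inv(R)` is a transitive role name. -/
def Trans (H : RBox NR) (R : Role NR) : Prop :=
  R.base ∈ H.transNames

/-- A role is simple if neither it nor any of its sub-roles is transitive. -/
def Simple (H : RBox NR) (R : Role NR) : Prop :=
  ∀ S : Role NR, H.Sub S R → ¬ H.Trans S

end RBox

/-! ### Concepts -/

/-- Concept expressions over the concept names `NC` and role names `NR`. -/
inductive Concept (NC NR : Type*) where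
  | atom : NC → Concept NC NR
  | neg : Concept NC NR → Concept NC NR
  | and : Concept NC NR → Concept NC NR → Concept NC NR
  | or : Concept NC NR → Concept NC NR → Concept NC NR
  | all : Role NR → Concept NC NR → Concept NC NR
  | ex : Role NR → Concept NC NR → Concept NC NR
  | atLeast : ℕ → Role NR → Concept NC NR → Concept NC NR
  | atMost : ℕ → Role NR → Concept NC NR → Concept NC NR
  /-- `M r R. C` -/
  | more : ℚ → Role NR → Concept NC NR → Concept NC NR
  /-- `W r R. C` -/
  | weak : ℚ → Role NR → Concept NC NR → Concept NC NR

namespace Concept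

variable {NC NR : Type*}

/-- The syntactic side conditions on concepts: roles in number restrictions and in part
restrictions are simple, and the indices of part restrictions belong to `Q₀`. -/
def IsConcept (H : RBox NR) (Q₀ : Set ℚ) : Concept NC NR → Prop
  | .atom _ => True
  | .neg C => C.IsConcept H Q₀
  | .and C D => C.IsConcept H Q₀ ∧ D.IsConcept H Q₀
  | .or C D => C.IsConcept H Q₀ ∧ D.IsConcept H Q₀
  | .all _ C => C.IsConcept H Q₀
  | .ex _ C => C.IsConcept H Q₀
  | .atLeast _ R C => H.Simple R ∧ C.IsConcept H Q₀
  | .atMost _ R C => H.Simple R ∧ C.IsConcept H Q₀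
  | .more r R C => r ∈ Q₀ ∧ H.Simple R ∧ C.IsConcept H Q₀
  | .weak r R C => r ∈ Q₀ ∧ H.Simple R ∧ C.IsConcept H Q₀

/-- Negation normal form: negation only in front of concept names. -/
def IsNNF : Concept NC NR → Prop
  | .atom _ => True
  | .neg (.atom _) => True
  | .neg _ => False
  | .and C D => C.IsNNF ∧ D.IsNNF
  | .or C D => C.IsNNF ∧ D.IsNNF
  | .all _ C => C.IsNNF
  | .ex _ C => C.IsNNF
  | .atLeast _ _ C => C.IsNNF
  | .atMost _ _ C => C.IsNNF
  | .more _ _ C => C.IsNNF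
  | .weak _ _ C => C.IsNNF

mutual

/-- The negation normal form of `C`. -/
def nnf : Concept NC NR → Concept NC NR
  | .atom A => .atom A
  | .neg C => C.compl
  | .and C D => .and C.nnf D.nnf
  | .or C D => .or C.nnf D.nnf
  | .all R C => .all R C.nnf
  | .ex R C => .ex R C.nnf
  | .atLeast n R C => .atLeast n R C.nnf
  | .atMost n R C => .atMost n R C.nnf
  | .more r R C => .more r R C.nnf
  | .weak r R C => .weak r R C.nnf

/-- `∼ C`, the negation normal form of `¬ C`. The unsatisfiable `¬ ≥ 0 R. C` becomes the
contradiction `C ⊓ ∼ C`. -/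
def compl : Concept NC NR → Concept NC NR
  | .atom A => .neg (.atom A)
  | .neg C => C.nnf
  | .and C D => .or C.compl D.compl
  | .or C D => .and C.compl D.compl
  | .all R C => .ex R C.compl
  | .ex R C => .all R C.compl
  | .atLeast 0 _ C => .and C.nnf C.compl
  | .atLeast (n + 1) R C => .atMost n R C.nnf
  | .atMost n R C => .atLeast (n + 1) R C.nnf
  | .more r R C => .weak r R C.compl
  | .weak r R C => .more r R C.compl

end

/-- The immediate sub-concepts. -/
def children : Concept NC NR → Set (Concept NC NR)
  | .atom _ => ∅
  | .neg C => {C}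
  | .and C D => {C, D}
  | .or C D => {C, D}
  | .all _ C => {C}
  | .ex _ C => {C}
  | .atLeast _ _ C => {C}
  | .atMost _ _ C => {C}
  | .more _ _ C => {C}
  | .weak _ _ C => {C}

/-- The roles written in a concept. -/
def occ : Concept NC NR → Set (Role NR)
  | .atom _ => ∅
  | .neg C => C.occ
  | .and C D => C.occ ∪ D.occ
  | .or C D => C.occ ∪ D.occ
  | .all R C => {R} ∪ C.occ
  | .ex R C => {R} ∪ C.occ
  | .atLeast _ R C => {R} ∪ C.occ
  | .atMost _ R C => {R} ∪ C.occ
  | .more _ R C => {R} ∪ C.occ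
  | .weak _ R C => {R} ∪ C.occ

/-- The roles occurring in `D` and their inverses. -/
def roles (D : Concept NC NR) : Set (Role NR) :=
  {R | R ∈ D.occ ∨ R.inv ∈ D.occ}

/-- `E ∈ clos(D)`: the smallest set containing `D` and closed under sub-concepts and `∼`. -/
inductive Clos (D : Concept NC NR) : Concept NC NR → Prop
  | self : Clos D D
  | child {C E : Concept NC NR} : Clos D C → E ∈ C.children → Clos D E
  | compl {C : Concept NC NR} : Clos D C → Clos D C.compl

/-- The concepts allowed in labels: `clos(D)` together with the value restrictions `∀ R. C`
that transitive sub-roles `R` of `S` produce from some `∀ S. C` in `clos(D)`. -/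
def labels (H : RBox NR) (D : Concept NC NR) : Set (Concept NC NR) :=
  {E | D.Clos E ∨ ∃ (R S : Role NR) (C : Concept NC NR),
    E = .all R C ∧ D.Clos (.all S C) ∧ H.Trans R ∧ H.Sub R S}

/-- `E` has the form `⊠ R. C`, where `⊠` is one of `∃`, `≥ n`, `≤ n`, `M r`, `W r`. -/
inductive IsBox (R : Role NR) (C : Concept NC NR) : Concept NC NR → Prop
  | ex : IsBox R C (.ex R C)
  | atLeast (n : ℕ) : IsBox R C (.atLeast n R C)
  | atMost (n : ℕ) : IsBox R C (.atMost n R C)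
  | more (r : ℚ) : IsBox R C (.more r R C)
  | weak (r : ℚ) : IsBox R C (.weak r R C)

end Concept

/-! ### Tableaux -/

section Tableau

variable {NC NR : Type*}

/-- `(S, L, E)` is a tableau for `D` with respect to the role hierarchy of `H`. Only the values of
`E` at the roles in `D.roles` matter. -/
structure IsTableau (H : RBox NR) (D : Concept NC NR) (S : Type)
    (L : S → Set (Concept NC NR)) (E : Role NR → S → S → Prop) : Prop where
  label_subset : ∀ s, L s ⊆ D.labels H
  root : ∃ s, D ∈ L s
  /-- All neighbour sets are finite, so that their cardinalities are natural numbers. -/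
  finite : ∀ s, ∀ R ∈ D.roles, {t | E R s t}.Finite
  p1 : ∀ s C, C ∈ L s → Concept.neg C ∉ L s
  p2 : ∀ s C₁ C₂, Concept.and C₁ C₂ ∈ L s → C₁ ∈ L s ∧ C₂ ∈ L s
  p3 : ∀ s C₁ C₂, Concept.or C₁ C₂ ∈ L s → C₁ ∈ L s ∨ C₂ ∈ L s
  p4 : ∀ s t C, ∀ R ∈ D.roles, Concept.all R C ∈ L s → E R s t → C ∈ L t
  p5 : ∀ s C, ∀ R ∈ D.roles, Concept.ex R C ∈ L s → ∃ t, E R s t ∧ C ∈ L t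
  p6 : ∀ s t C, ∀ R ∈ D.roles, ∀ S ∈ D.roles, Concept.all S C ∈ L s → E R s t →
    H.Sub R S → H.Trans R → Concept.all R C ∈ L t
  p7 : ∀ s t, ∀ R ∈ D.roles, E R s t ↔ E R.inv t s
  p8 : ∀ s t, ∀ R ∈ D.roles, ∀ S ∈ D.roles, E R s t → H.Sub R S → E S s t
  p9 : ∀ s C n, ∀ R ∈ D.roles, Concept.atMost n R C ∈ L s →
    {t | E R s t ∧ C ∈ L t}.ncard ≤ n
  p10 : ∀ s C n, ∀ R ∈ D.roles, Concept.atLeast n R C ∈ L s →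
    n ≤ {t | E R s t ∧ C ∈ L t}.ncard
  p11 : ∀ s C r, ∀ R ∈ D.roles, Concept.more r R C ∈ L s →
    r * ({t | E R s t}.ncard : ℚ) < ({t | E R s t ∧ C ∈ L t}.ncard : ℚ)
  p12 : ∀ s C r, ∀ R ∈ D.roles, Concept.weak r R C ∈ L s →
    ({t | E R s t ∧ C.compl ∈ L t}.ncard : ℚ) ≤ r * ({t | E R s t}.ncard : ℚ)
  p13 : ∀ s t C F, ∀ R ∈ D.roles, Concept.IsBox R C F → F ∈ L s → E R s t →
    C ∈ L t ∨ C.compl ∈ L t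

/-- `D` has a tableau with respect to the role hierarchy of `H`. -/
def HasTableau (H : RBox NR) (D : Concept NC NR) : Prop :=
  ∃ (S : Type) (L : S → Set (Concept NC NR)) (E : Role NR → S → S → Prop), IsTableau H D S L E

end Tableau

/-! ### Completion trees -/

/-- Nodes are addresses: `[]` is the root, and the successors of `x` are the nodes `k :: x`. -/
abbrev Node : Type := List ℕ

/-- `y` is a successor of `x` (and `x` the predecessor of `y`). -/
def IsSucc (x y : Node) : Prop := ∃ k : ℕ, y = k :: x

/-- `y` is a (proper) ancestor of `x`. -/
def IsAncestor (y x : Node) : Prop := y <:+ x ∧ y ≠ x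

/-- A finite tree whose nodes are labelled with sets of concepts and whose edges are labelled with
sets of roles; `edge y` is the label of the edge from the predecessor of `y` to `y`. -/
structure CTree (NC NR : Type*) where
  nodes : Finset Node
  label : Node → Set (Concept NC NR)
  edge : Node → Set (Role NR)

namespace CTree

variable {NC NR : Type*}

/-- The single root with label `{D}`. -/
def init (D : Concept NC NR) : CTree NC NR where
  nodes := {[]}
  label := Function.update (fun _ => ∅) [] {D}
  edge := fun _ => ∅

/-- `y` is an `R`-successor of `x`. -/
def RSucc (H : RBox NR) (T : CTree NC NR) (R : Role NR) (x y : Node) : Prop :=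
  x ∈ T.nodes ∧ y ∈ T.nodes ∧ IsSucc x y ∧ ∃ S ∈ T.edge y, H.Sub S R

/-- `y` is an `R`-neighbour of `x`. -/
def RNbr (H : RBox NR) (T : CTree NC NR) (R : Role NR) (x y : Node) : Prop :=
  T.RSucc H R x y ∨ T.RSucc H R.inv y x

/-- The number of `R`-neighbours of `x`. -/
noncomputable def numNbr (H : RBox NR) (T : CTree NC NR) (R : Role NR) (x : Node) : ℕ :=
  {y | T.RNbr H R x y}.ncard

/-- The number of `R`-neighbours of `x` labelled with `C`. -/
noncomputable def numNbrWith (H : RBox NR) (T : CTree NC NR) (R : Role NR) (x : Node)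
    (C : Concept NC NR) : ℕ :=
  {y | T.RNbr H R x y ∧ C ∈ T.label y}.ncard

/-- The label of the edge between `x` and `y` read from `x` to `y`: an edge from `y` to its
successor `x` is read with inverse roles. -/
def between (T : CTree NC NR) (x y : Node) : Set (Role NR) :=
  {S | (IsSucc x y ∧ S ∈ T.edge y) ∨ (IsSucc y x ∧ S.inv ∈ T.edge x)}

/-! #### Pair-wise blocking -/

/-- `y` and its predecessor `y'` look like `x` and its predecessor `x'`, where `x'`, `y` and `y'`
are ancestors of `x`. -/
def Matches (T : CTree NC NR) (y x : Node) : Prop :=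
  ∃ x' y' : Node, IsAncestor x' x ∧ IsAncestor y x ∧ IsAncestor y' x ∧
    IsSucc x' x ∧ IsSucc y' y ∧
    T.label x = T.label y ∧ T.label x' = T.label y' ∧ T.edge x = T.edge y

/-- A node is blocked if its predecessor is blocked, or the edge leading to it has the empty label
(it has been merged into another node), or it matches one of its ancestors. -/
def Blocked (T : CTree NC NR) : Node → Prop
  | [] => False
  | k :: p => T.Blocked p ∨ T.edge (k :: p) = ∅ ∨ ∃ y, T.Matches y (k :: p)

/-- `y` blocks `x`. -/
def Blocks (T : CTree NC NR) (y x : Node) : Prop :=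
  (∀ z, IsAncestor z x → ¬ T.Blocked z) ∧ T.Matches y x

/-- `x` is directly blocked. -/
def DirectlyBlocked (T : CTree NC NR) (x : Node) : Prop :=
  ∃ y, T.Blocks y x

/-- `x` is indirectly blocked: its predecessor is blocked, or it has been merged. -/
def IndirectlyBlocked (T : CTree NC NR) : Node → Prop
  | [] => False
  | k :: p => T.Blocked p ∨ T.edge (k :: p) = ∅

theorem blocked_of_suffix (T : CTree NC NR) {z : Node} (hz : T.Blocked z) :
    ∀ x : Node, z <:+ x → T.Blocked x
  | [], h => by
    have : z = [] := List.suffix_nil.mp h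
    rwa [← this]
  | k :: p, h => by
    rcases List.suffix_cons_iff.mp h with h | h
    · rwa [← h]
    · exact Or.inl (T.blocked_of_suffix hz p h)

/-- Blocked means directly or indirectly blocked. -/
theorem blocked_iff (T : CTree NC NR) (x : Node) :
    T.Blocked x ↔ T.DirectlyBlocked x ∨ T.IndirectlyBlocked x := by
  cases x with
  | nil =>
    refine ⟨fun h => h.elim, ?_⟩
    rintro (⟨y, -, x', y', -, -, -, ⟨k, hk⟩, -⟩ | h)
    · exact absurd hk (by simp)
    · exact h.elim
  | cons k p =>
    constructor
    · rintro (h | h | ⟨y, hy⟩)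
      · exact Or.inr (Or.inl h)
      · exact Or.inr (Or.inr h)
      · by_cases hp : T.Blocked p
        · exact Or.inr (Or.inl hp)
        · refine Or.inl ⟨y, fun z hz hb => hp ?_, hy⟩
          rcases List.suffix_cons_iff.mp hz.1 with h | h
          · exact absurd h hz.2
          · exact T.blocked_of_suffix hb p h
    · rintro (⟨y, -, hy⟩ | h | h)
      · exact Or.inr (Or.inr ⟨y, hy⟩)
      · exact Or.inl h
      · exact Or.inr (Or.inl h)

/-! #### Clashes -/

def Clash1 (T : CTree NC NR) : Prop :=
  ∃ x ∈ T.nodes, ∃ C, C ∈ T.label x ∧ Concept.neg C ∈ T.label x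

def Clash2 (H : RBox NR) (T : CTree NC NR) : Prop :=
  ∃ x ∈ T.nodes, ∃ n R C, Concept.atMost n R C ∈ T.label x ∧ n < T.numNbrWith H R x C

def Clash3 (H : RBox NR) (T : CTree NC NR) : Prop :=
  ∃ x ∈ T.nodes, ∃ r R C, Concept.more r R C ∈ T.label x ∧
    (T.numNbrWith H R x C : ℚ) ≤ r * (T.numNbr H R x : ℚ)

def Clash4 (H : RBox NR) (T : CTree NC NR) : Prop :=
  ∃ x ∈ T.nodes, ∃ r R C, Concept.weak r R C ∈ T.label x ∧
    r * (T.numNbr H R x : ℚ) < (T.numNbrWith H R x C.compl : ℚ)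

def ClashFree (H : RBox NR) (T : CTree NC NR) : Prop :=
  ¬ T.Clash1 ∧ ¬ T.Clash2 H ∧ ¬ T.Clash3 H ∧ ¬ T.Clash4 H

/-! #### Completion rules -/

/-- Add the concepts in `X` to the label of `y`. -/
def addLabel (T : CTree NC NR) (y : Node) (X : Set (Concept NC NR)) : CTree NC NR where
  nodes := T.nodes
  label := Function.update T.label y (T.label y ∪ X)
  edge := T.edge

/-- Create the node `y` with label `{C}`, the edge to it being labelled `{R}`. -/
def addNode (T : CTree NC NR) (y : Node) (R : Role NR) (C : Concept NC NR) : CTree NC NR where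
  nodes := insert y T.nodes
  label := Function.update T.label y {C}
  edge := Function.update T.edge y {R}

open Classical in
/-- Merge the successor `y` of `x` into the neighbour `z` of `x`. -/
noncomputable def merge (T : CTree NC NR) (x y z : Node) : CTree NC NR where
  nodes := T.nodes
  label := Function.update T.label z (T.label z ∪ T.label y)
  edge := Function.update
    (if IsSucc z x then Function.update T.edge x (T.edge x ∪ Role.inv '' T.edge y)
      else Function.update T.edge z (T.edge z ∪ T.edge y))
    y ∅

/-- The applications of the non-generating rules, with their results. -/
inductive NonGen (H : RBox NR) (T : CTree NC NR) : CTree NC NR → Prop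
  | and {x : Node} {C₁ C₂ : Concept NC NR} :
      x ∈ T.nodes → Concept.and C₁ C₂ ∈ T.label x → ¬ T.IndirectlyBlocked x →
      ¬ (C₁ ∈ T.label x ∧ C₂ ∈ T.label x) →
      NonGen H T (T.addLabel x {C₁, C₂})
  | or {x : Node} {C₁ C₂ E : Concept NC NR} :
      x ∈ T.nodes → Concept.or C₁ C₂ ∈ T.label x → ¬ T.IndirectlyBlocked x →
      C₁ ∉ T.label x → C₂ ∉ T.label x → (E = C₁ ∨ E = C₂) →
      NonGen H T (T.addLabel x {E})
  | all {x y : Node} {R : Role NR} {C : Concept NC NR} :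
      x ∈ T.nodes → Concept.all R C ∈ T.label x → ¬ T.IndirectlyBlocked x →
      T.RNbr H R x y → C ∉ T.label y →
      NonGen H T (T.addLabel y {C})
  | allPlus {x y : Node} {R S : Role NR} {C : Concept NC NR} :
      x ∈ T.nodes → Concept.all S C ∈ T.label x → ¬ T.IndirectlyBlocked x →
      H.Trans R → H.Sub R S →
      T.RNbr H R x y → Concept.all R C ∉ T.label y →
      NonGen H T (T.addLabel y {Concept.all R C})
  | choose {x y : Node} {R : Role NR} {C E F : Concept NC NR} :
      x ∈ T.nodes → Concept.IsBox R C F → F ∈ T.label x → ¬ T.IndirectlyBlocked x →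
      T.RNbr H R x y → C ∉ T.label y → C.compl ∉ T.label y → (E = C ∨ E = C.compl) →
      NonGen H T (T.addLabel y {E})
  | atMost {x y z : Node} {n : ℕ} {R : Role NR} {C : Concept NC NR} :
      x ∈ T.nodes → Concept.atMost n R C ∈ T.label x → ¬ T.IndirectlyBlocked x →
      n < T.numNbrWith H R x C →
      T.RNbr H R x y → T.RNbr H R x z → y ≠ z → C ∈ T.label y → C ∈ T.label z →
      T.between x y ∩ T.between x z = ∅ → ¬ IsSucc y x →
      NonGen H T (T.merge x y z)

/-- The applications of the generating rules, with their results. `ban T x` is the border amount of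
neighbours used for the node `x` of `T`. -/
inductive Gen (H : RBox NR) (ban : CTree NC NR → Node → ℕ) (T : CTree NC NR) : CTree NC NR → Prop
  | ex {x y : Node} {R : Role NR} {C : Concept NC NR} :
      x ∈ T.nodes → Concept.ex R C ∈ T.label x → ¬ T.Blocked x →
      (¬ ∃ z, T.RNbr H R x z ∧ C ∈ T.label z) →
      IsSucc x y → y ∉ T.nodes → Gen H ban T (T.addNode y R C)
  | atLeast {x y : Node} {n : ℕ} {R : Role NR} {C : Concept NC NR} :
      x ∈ T.nodes → Concept.atLeast n R C ∈ T.label x → ¬ T.Blocked x →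
      T.numNbrWith H R x C < n →
      IsSucc x y → y ∉ T.nodes → Gen H ban T (T.addNode y R C)
  | more {x y : Node} {r : ℚ} {R : Role NR} {C : Concept NC NR} :
      x ∈ T.nodes → Concept.more r R C ∈ T.label x → ¬ T.Blocked x →
      (T.numNbrWith H R x C : ℚ) ≤ r * (T.numNbr H R x : ℚ) →
      T.numNbr H R x < ban T x →
      IsSucc x y → y ∉ T.nodes → Gen H ban T (T.addNode y R C)
  | weak {x y : Node} {r : ℚ} {R : Role NR} {C : Concept NC NR} :
      x ∈ T.nodes → Concept.weak r R C ∈ T.label x → ¬ T.Blocked x →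
      r * (T.numNbr H R x : ℚ) < (T.numNbrWith H R x C.compl : ℚ) →
      T.numNbr H R x < ban T x →
      IsSucc x y → y ∉ T.nodes → Gen H ban T (T.addNode y R C)

/-- One rule application under the strategy that a generating rule is applied only if no
non-generating rule is applicable. -/
def Step (H : RBox NR) (ban : CTree NC NR → Node → ℕ) (T T' : CTree NC NR) : Prop :=
  T.NonGen H T' ∨ ((¬ ∃ T'', T.NonGen H T'') ∧ T.Gen H ban T')

/-- The completion rules, applied to `D`, can yield `T`. -/
def Yields (H : RBox NR) (ban : CTree NC NR → Node → ℕ) (D : Concept NC NR)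
    (T : CTree NC NR) : Prop :=
  Relation.ReflTransGen (Step H ban) (init D) T

/-- `T` is complete: no completion rule is applicable, or some node label contains a clash of the
first or of the second type. -/
def Complete (H : RBox NR) (ban : CTree NC NR → Node → ℕ) (T : CTree NC NR) : Prop :=
  ((¬ ∃ T', T.NonGen H T') ∧ (¬ ∃ T', T.Gen H ban T')) ∨ T.Clash1 ∨ T.Clash2 H

end CTree

end ALCQPIH

namespace ALCQPIH

variable {NC NR : Type*}

theorem Role.inv_inv (R : Role NR) : R.inv.inv = R := by
  cases R <;> rfl

theorem RBox.Base.inv {H : RBox NR} {R S : Role NR} (h : H.Base R S) : H.Base R.inv S.inv := by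
  rcases h with h | ⟨R', S', h, rfl, rfl⟩
  · exact Or.inr ⟨R, S, h, rfl, rfl⟩
  · rw [Role.inv_inv, Role.inv_inv]
    exact Or.inl h

theorem RBox.Sub.inv {H : RBox NR} {R S : Role NR} (h : H.Sub R S) : H.Sub R.inv S.inv := by
  induction h with
  | refl => exact .refl
  | tail _ h ih => exact ih.tail h.inv

namespace Concept

variable {H : RBox NR} {D : Concept NC NR}

theorem Clos.mem_labels {C : Concept NC NR} (h : D.Clos C) : C ∈ D.labels H := Or.inl h

theorem clos_of_all_mem_labels {R : Role NR} {C : Concept NC NR} (h : all R C ∈ D.labels H) :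
    D.Clos C := by
  rcases h with h | ⟨R', S, C', hE, h, -, -⟩
  · exact h.child rfl
  · cases hE
    exact h.child rfl

theorem all_mem_labels_of_sub {R S : Role NR} {C : Concept NC NR} (h : all S C ∈ D.labels H)
    (hT : H.Trans R) (hS : H.Sub R S) : all R C ∈ D.labels H := by
  rcases h with h | ⟨S', S'', C', hE, h, -, hS'⟩
  · exact Or.inr ⟨R, S, C, rfl, h, hT, hS⟩
  · cases hE
    exact Or.inr ⟨R, S'', C, rfl, h, hT, hS.trans hS'⟩

theorem clos_of_isBox {R : Role NR} {C F : Concept NC NR} (hF : IsBox R C F)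
    (h : F ∈ D.labels H) : D.Clos C := by
  rcases h with h | ⟨R', S', C', rfl, -⟩
  · cases hF <;> exact h.child rfl
  · cases hF

theorem clos_of_and_mem_labels {C₁ C₂ : Concept NC NR} (h : and C₁ C₂ ∈ D.labels H) :
    D.Clos C₁ ∧ D.Clos C₂ := by
  rcases h with h | ⟨R', S', C', hE, -⟩
  · exact ⟨h.child (Or.inl rfl), h.child (Or.inr rfl)⟩
  · cases hE

theorem clos_of_or_mem_labels {C₁ C₂ : Concept NC NR} (h : or C₁ C₂ ∈ D.labels H) :
    D.Clos C₁ ∧ D.Clos C₂ := by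
  rcases h with h | ⟨R', S', C', hE, -⟩
  · exact ⟨h.child (Or.inl rfl), h.child (Or.inr rfl)⟩
  · cases hE

end Concept

namespace CTree

/-- The properties of completion trees for `D` that every rule preserves. -/
structure WellFormed (H : RBox NR) (D : Concept NC NR) (T : CTree NC NR) : Prop where
  root_mem : [] ∈ T.nodes
  pred_mem : ∀ k x, k :: x ∈ T.nodes → x ∈ T.nodes
  root_label : D ∈ T.label []
  label_subset : ∀ x, T.label x ⊆ D.labels H

variable {H : RBox NR} {D : Concept NC NR} {T : CTree NC NR}

theorem wellFormed_init : (init D).WellFormed H D where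
  root_mem := by simp [init]
  pred_mem := by simp [init]
  root_label := by simp [init]
  label_subset x := by
    intro C hC
    by_cases hx : x = []
    · subst hx
      have : C = D := by simpa [init] using hC
      exact this ▸ Concept.Clos.self.mem_labels
    · simp [init, Function.update_of_ne hx] at hC

theorem WellFormed.update_label (hT : T.WellFormed H D) {y : Node} {X : Set (Concept NC NR)}
    (hX : X ⊆ D.labels H) (e : Node → Set (Role NR)) :
    WellFormed H D ⟨T.nodes, Function.update T.label y (T.label y ∪ X), e⟩ where
  root_mem := hT.root_mem
  pred_mem := hT.pred_mem
  root_label := by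
    by_cases hy : [] = y
    · subst hy
      simpa using Or.inl hT.root_label
    · simpa [Function.update_of_ne hy] using hT.root_label
  label_subset x := by
    by_cases hx : x = y
    · subst hx
      simpa using ⟨hT.label_subset x, hX⟩
    · simpa [Function.update_of_ne hx] using hT.label_subset x

theorem WellFormed.addNode (hT : T.WellFormed H D) {x y : Node} {R : Role NR}
    {C : Concept NC NR} (hC : C ∈ D.labels H) (hx : x ∈ T.nodes) (hxy : IsSucc x y) :
    (T.addNode y R C).WellFormed H D := by
  obtain ⟨k, rfl⟩ := hxy
  refine ⟨Finset.mem_insert_of_mem hT.root_mem, fun j z hz => ?_, ?_, fun z => ?_⟩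
  · rcases Finset.mem_insert.mp hz with hz | hz
    · cases hz
      exact Finset.mem_insert_of_mem hx
    · exact Finset.mem_insert_of_mem (hT.pred_mem j z hz)
  · simpa [CTree.addNode, Function.update_of_ne] using hT.root_label
  · by_cases hz : z = k :: x
    · subst hz
      simpa [CTree.addNode] using hC
    · simpa [CTree.addNode, Function.update_of_ne hz] using hT.label_subset z

theorem WellFormed.nonGen (hT : T.WellFormed H D) {T' : CTree NC NR} (h : T.NonGen H T') :
    T'.WellFormed H D := by
  cases h with
  | @and x C₁ C₂ hx h _ _ =>
    have := Concept.clos_of_and_mem_labels (hT.label_subset x h)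
    refine hT.update_label ?_ _
    rintro E (rfl | rfl)
    exacts [this.1.mem_labels, this.2.mem_labels]
  | @or x C₁ C₂ E hx h _ _ _ hE =>
    have := Concept.clos_of_or_mem_labels (hT.label_subset x h)
    refine hT.update_label (Set.singleton_subset_iff.mpr ?_) _
    rcases hE with rfl | rfl
    exacts [this.1.mem_labels, this.2.mem_labels]
  | @all x y R C hx h _ _ _ =>
    exact hT.update_label (Set.singleton_subset_iff.mpr
      (Concept.clos_of_all_mem_labels (hT.label_subset x h)).mem_labels) _
  | @allPlus x y R S C hx h _ hR hS _ _ =>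
    exact hT.update_label (Set.singleton_subset_iff.mpr
      (Concept.all_mem_labels_of_sub (hT.label_subset x h) hR hS)) _
  | @choose x y R C E F hx hF h _ _ _ _ hE =>
    have := Concept.clos_of_isBox hF (hT.label_subset x h)
    refine hT.update_label (Set.singleton_subset_iff.mpr ?_) _
    rcases hE with rfl | rfl
    exacts [this.mem_labels, this.compl.mem_labels]
  | atMost => exact hT.update_label (hT.label_subset _) _

theorem WellFormed.gen (hT : T.WellFormed H D) {ban : CTree NC NR → Node → ℕ}
    {T' : CTree NC NR} (h : T.Gen H ban T') : T'.WellFormed H D := by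
  cases h with
  | @ex x y R C hx h _ _ hy _ =>
    exact hT.addNode (Concept.clos_of_isBox .ex (hT.label_subset x h)).mem_labels hx hy
  | @atLeast x y n R C hx h _ _ hy _ =>
    exact hT.addNode (Concept.clos_of_isBox (.atLeast n) (hT.label_subset x h)).mem_labels hx hy
  | @more x y r R C hx h _ _ _ hy _ =>
    exact hT.addNode (Concept.clos_of_isBox (.more r) (hT.label_subset x h)).mem_labels hx hy
  | @weak x y r R C hx h _ _ _ hy _ =>
    exact hT.addNode (Concept.clos_of_isBox (.weak r) (hT.label_subset x h)).mem_labels hx hy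

theorem Yields.wellFormed {ban : CTree NC NR → Node → ℕ} (h : Yields H ban D T) :
    T.WellFormed H D := by
  induction h with
  | refl => exact wellFormed_init
  | tail _ hs ih =>
    rcases hs with hs | ⟨-, hs⟩
    exacts [ih.nonGen hs, ih.gen hs]

theorem WellFormed.mem_of_suffix (hT : T.WellFormed H D) {z : Node} :
    ∀ x : Node, x ∈ T.nodes → z <:+ x → z ∈ T.nodes
  | [], hx, h => by rwa [List.suffix_nil.mp h]
  | k :: x, hx, h => by
    rcases List.suffix_cons_iff.mp h with h | h
    · rwa [h]
    · exact hT.mem_of_suffix x (hT.pred_mem k x hx) h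

theorem exists_fresh_succ (T : CTree NC NR) (x : Node) : ∃ y, IsSucc x y ∧ y ∉ T.nodes := by
  have hinj : Function.Injective (fun k : ℕ => k :: x) := fun a b h => by simpa using h
  obtain ⟨y, ⟨k, rfl⟩, hy⟩ := (Set.infinite_range_of_injective hinj).exists_notMem_finset T.nodes
  exact ⟨_, ⟨k, rfl⟩, hy⟩

theorem not_indirectlyBlocked {x : Node} (h : ¬ T.Blocked x) : ¬ T.IndirectlyBlocked x :=
  fun h' => h ((T.blocked_iff x).mpr (Or.inr h'))

open Classical in
/-- The node that represents `x` in the unravelling: the node blocking `x` if `x` is directly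
blocked, and `x` itself otherwise. -/
noncomputable def rep (T : CTree NC NR) (x : Node) : Node :=
  if h : T.DirectlyBlocked x then h.choose else x

theorem rep_eq_or_blocks (T : CTree NC NR) (x : Node) :
    (¬ T.DirectlyBlocked x ∧ T.rep x = x) ∨ T.Blocks (T.rep x) x := by
  by_cases h : T.DirectlyBlocked x
  · right
    rw [rep, dif_pos h]
    exact h.choose_spec
  · exact Or.inl ⟨h, dif_neg h⟩

theorem label_rep (T : CTree NC NR) (x : Node) : T.label (T.rep x) = T.label x := by
  rcases T.rep_eq_or_blocks x with ⟨-, h⟩ | ⟨-, _, _, -, -, -, -, -, h, -⟩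
  · rw [h]
  · exact h.symm

theorem rep_nil (T : CTree NC NR) : T.rep [] = [] := by
  rcases T.rep_eq_or_blocks [] with ⟨-, h⟩ | ⟨-, _, _, -, -, -, ⟨k, hk⟩, -⟩
  · exact h
  · exact absurd hk (by simp)

theorem rep_cons (T : CTree NC NR) (k : ℕ) (x : Node) :
    ∃ j u, T.rep (k :: x) = j :: u ∧ T.label u = T.label x ∧
      T.edge (T.rep (k :: x)) = T.edge (k :: x) := by
  rcases T.rep_eq_or_blocks (k :: x) with
    ⟨-, h⟩ | ⟨-, x', y', -, -, -, ⟨k', hk⟩, ⟨j, hj⟩, -, hp, he⟩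
  · exact ⟨k, x, h, rfl, by rw [h]⟩
  · cases hk
    exact ⟨j, y', hj, hp.symm, he.symm⟩

theorem not_blocked_rep {x : Node} (hx : ¬ T.IndirectlyBlocked x) : ¬ T.Blocked (T.rep x) := by
  rcases T.rep_eq_or_blocks x with ⟨h, h'⟩ | ⟨h, _, _, -, h', -⟩
  · rw [h', T.blocked_iff]
    exact fun hb => hb.elim h hx
  · exact h _ h'

theorem WellFormed.rep_mem (hT : T.WellFormed H D) {x : Node} (hx : x ∈ T.nodes) :
    T.rep x ∈ T.nodes := by
  rcases T.rep_eq_or_blocks x with ⟨-, h⟩ | ⟨-, _, _, -, h, -⟩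
  · rwa [h]
  · exact hT.mem_of_suffix x hx h.1

/-- The paths through `T` that continue at the blocking node whenever they reach a directly blocked
node; the last node of a path comes first. -/
def IsPath (T : CTree NC NR) : List Node → Prop
  | [] => False
  | [x] => x = []
  | y :: x :: p => T.IsPath (x :: p) ∧ IsSucc (T.rep x) y ∧ y ∈ T.nodes ∧ T.edge y ≠ ∅

theorem WellFormed.path_head (hT : T.WellFormed H D) :
    ∀ (x : Node) (p : List Node), T.IsPath (x :: p) → x ∈ T.nodes ∧ ¬ T.IndirectlyBlocked x
  | x, [], h => by
    obtain rfl : x = [] := h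
    exact ⟨hT.root_mem, id⟩
  | y, x :: p, ⟨hp, ⟨k, hk⟩, hy, he⟩ => by
    refine ⟨hy, ?_⟩
    subst hk
    rintro (h | h)
    · exact not_blocked_rep (hT.path_head x p hp).2 h
    · exact he h

/-- The nodes of the unravelling of `T`. -/
abbrev Path (T : CTree NC NR) : Type := {p : List Node // T.IsPath p}

namespace Path

/-- The last node of a path. -/
def last (s : T.Path) : Node := s.1.headI

/-- The label of a path. -/
def label (s : T.Path) : Set (Concept NC NR) := T.label s.last

/-- The node of `T` whose neighbours are copied by the neighbours of `s`. -/
noncomputable def node (s : T.Path) : Node := T.rep s.last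

/-- `t` is an `R`-neighbour of `s` in the unravelling. -/
def Rel (H : RBox NR) (R : Role NR) (s t : T.Path) : Prop :=
  (∃ y, t.1 = y :: s.1 ∧ ∃ S ∈ T.edge y, H.Sub S R) ∨
    (∃ y, s.1 = y :: t.1 ∧ ∃ S ∈ T.edge y, H.Sub S R.inv)

open Classical in
/-- The neighbour of `s.node` corresponding to the neighbour `t` of `s`. -/
noncomputable def nbr (s t : T.Path) : Node :=
  if s.1.length < t.1.length then t.last else s.node.tail

theorem label_node (s : T.Path) : T.label s.node = s.label := T.label_rep s.last

theorem exists_eq_cons (s : T.Path) : ∃ p, s.1 = s.last :: p := by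
  obtain ⟨_ | ⟨x, p⟩, hs⟩ := s
  · exact hs.elim
  · exact ⟨p, rfl⟩

theorem last_spec (hT : T.WellFormed H D) (s : T.Path) :
    s.last ∈ T.nodes ∧ ¬ T.IndirectlyBlocked s.last := by
  obtain ⟨p, hp⟩ := s.exists_eq_cons
  exact hT.path_head s.last p (hp ▸ s.2)

theorem node_mem (hT : T.WellFormed H D) (s : T.Path) : s.node ∈ T.nodes :=
  hT.rep_mem (s.last_spec hT).1

theorem not_blocked_node (hT : T.WellFormed H D) (s : T.Path) : ¬ T.Blocked s.node :=
  not_blocked_rep (s.last_spec hT).2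

theorem last_of_eq_cons {s : T.Path} {y : Node} {p : List Node} (h : s.1 = y :: p) :
    s.last = y := by
  simp [last, h]

theorem isSucc_of_eq_cons {s t : T.Path} {y : Node} (h : t.1 = y :: s.1) :
    IsSucc s.node y ∧ y ∈ T.nodes ∧ T.edge y ≠ ∅ := by
  obtain ⟨p, hp⟩ := s.exists_eq_cons
  have ht := t.2
  rw [h, hp] at ht
  exact ht.2

theorem nbr_of_succ {s t : T.Path} {y : Node} (h : t.1 = y :: s.1) : nbr s t = y := by
  rw [nbr, if_pos (by simp [h]), last_of_eq_cons h]

theorem nbr_of_pred {s t : T.Path} {y : Node} (h : s.1 = y :: t.1) : nbr s t = s.node.tail :=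
  if_neg (by simp [h])

/-- The predecessor of `s.node` looks like the predecessor `t` of the path `s`. -/
theorem node_of_pred {s t : T.Path} {y : Node} (h : s.1 = y :: t.1) :
    ∃ j u, s.node = j :: u ∧ T.label u = t.label ∧ T.edge s.node = T.edge y := by
  obtain ⟨⟨k, rfl⟩, -, -⟩ := isSucc_of_eq_cons h
  obtain ⟨j, u, h₁, h₂, h₃⟩ := T.rep_cons k t.node
  rw [← last_of_eq_cons h] at h₁ h₃
  exact ⟨j, u, h₁, h₂.trans t.label_node, h₃.trans (by rw [last_of_eq_cons h])⟩

theorem label_nbr {R : Role NR} {s t : T.Path} (h : Rel H R s t) :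
    T.label (nbr s t) = t.label := by
  rcases h with ⟨y, h, -⟩ | ⟨y, h, -⟩
  · rw [nbr_of_succ h, label, last_of_eq_cons h]
  · obtain ⟨j, u, hu, hl, -⟩ := node_of_pred h
    rw [nbr_of_pred h, hu]
    exact hl

theorem rNbr_nbr (hT : T.WellFormed H D) {R : Role NR} {s t : T.Path} (h : Rel H R s t) :
    T.RNbr H R s.node (nbr s t) := by
  rcases h with ⟨y, h, S, hS, hSR⟩ | ⟨y, h, S, hS, hSR⟩
  · obtain ⟨hy, hyT, -⟩ := isSucc_of_eq_cons h
    rw [nbr_of_succ h]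
    exact Or.inl ⟨s.node_mem hT, hyT, hy, S, hS, hSR⟩
  · obtain ⟨j, u, hu, -, he⟩ := node_of_pred h
    have hs := s.node_mem hT
    rw [nbr_of_pred h]
    rw [← he] at hS
    rw [hu] at hs hS ⊢
    exact Or.inr ⟨hT.pred_mem j u hs, hs, ⟨j, rfl⟩, S, hS, hSR⟩

theorem nbr_injOn (R : Role NR) (s : T.Path) : Set.InjOn (nbr s) {t | Rel H R s t} := by
  have key : ∀ {t t' : T.Path} {y y' : Node}, t.1 = y :: s.1 → s.1 = y' :: t'.1 →
      nbr s t ≠ nbr s t' := by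
    intro t t' y y' h h' heq
    obtain ⟨⟨k, rfl⟩, -, -⟩ := isSucc_of_eq_cons h
    rw [nbr_of_succ h, nbr_of_pred h'] at heq
    have := congrArg List.length heq
    simp only [List.length_cons, List.length_tail] at this
    omega
  rintro t (⟨y, h, -⟩ | ⟨y, h, -⟩) t' (⟨y', h', -⟩ | ⟨y', h', -⟩) heq
  · rw [nbr_of_succ h, nbr_of_succ h'] at heq
    exact Subtype.ext (by rw [h, h', heq])
  · exact (key h h' heq).elim
  · exact (key h' h heq.symm).elim
  · rw [h] at h'
    exact Subtype.ext (List.cons.inj h').2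

theorem exists_rel_of_rNbr {R : Role NR} {s : T.Path} {v : Node} (h : T.RNbr H R s.node v) :
    ∃ t, Rel H R s t ∧ nbr s t = v := by
  rcases h with ⟨-, hv, hsv, S, hS, hSR⟩ | ⟨-, -, ⟨k, hk⟩, S, hS, hSR⟩
  · obtain ⟨p, hp⟩ := s.exists_eq_cons
    have ht : T.IsPath (v :: s.1) := by
      have hs := s.2
      rw [hp] at hs ⊢
      exact ⟨hs, hsv, hv, Set.nonempty_iff_ne_empty.mp ⟨S, hS⟩⟩
    exact ⟨⟨v :: s.1, ht⟩, Or.inl ⟨v, rfl, S, hS, hSR⟩, nbr_of_succ rfl⟩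
  · obtain ⟨_ | ⟨y, _ | ⟨x, p⟩⟩, hs⟩ := s
    · exact hs.elim
    · obtain rfl : y = [] := hs
      exact absurd (T.rep_nil.symm.trans hk) (by simp)
    · let t : T.Path := ⟨x :: p, hs.1⟩
      obtain ⟨j, u, hu, -, he⟩ := node_of_pred (s := ⟨y :: x :: p, hs⟩) (t := t) rfl
      refine ⟨t, Or.inr ⟨y, rfl, S, he ▸ hS, hSR⟩, ?_⟩
      rw [nbr_of_pred (y := y) rfl, hk]
      rfl

theorem bijOn_nbr (hT : T.WellFormed H D) (R : Role NR) (s : T.Path) :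
    Set.BijOn (nbr s) {t | Rel H R s t} {v | T.RNbr H R s.node v} :=
  ⟨fun _ => rNbr_nbr hT, nbr_injOn R s, fun _ => exists_rel_of_rNbr⟩

theorem ncard_rel (hT : T.WellFormed H D) (R : Role NR) (s : T.Path) :
    {t | Rel H R s t}.ncard = T.numNbr H R s.node := by
  rw [numNbr, ← (bijOn_nbr hT R s).image_eq, (nbr_injOn R s).ncard_image]

theorem ncard_rel_with (hT : T.WellFormed H D) (R : Role NR) (s : T.Path) (C : Concept NC NR) :
    {t : T.Path | Rel H R s t ∧ C ∈ t.label}.ncard = T.numNbrWith H R s.node C := by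
  have : {v | T.RNbr H R s.node v ∧ C ∈ T.label v} =
      nbr s '' {t : T.Path | Rel H R s t ∧ C ∈ t.label} := by
    ext v
    constructor
    · rintro ⟨h, hC⟩
      obtain ⟨t, ht, rfl⟩ := exists_rel_of_rNbr h
      exact ⟨t, ⟨ht, label_nbr ht ▸ hC⟩, rfl⟩
    · rintro ⟨t, ⟨ht, hC⟩, rfl⟩
      exact ⟨rNbr_nbr hT ht, (label_nbr ht).symm ▸ hC⟩
  rw [numNbrWith, this, ((nbr_injOn R s).mono fun _ h => h.1).ncard_image]

theorem finite_rel (hT : T.WellFormed H D) (R : Role NR) (s : T.Path) :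
    {t | Rel H R s t}.Finite := by
  refine ((bijOn_nbr hT R s).finite_iff_finite).mpr (T.nodes.finite_toSet.subset ?_)
  rintro v (⟨-, h, -⟩ | ⟨h, -⟩) <;> exact h

theorem rel_inv (R : Role NR) (s t : T.Path) : Rel H R s t ↔ Rel H R.inv t s := by
  unfold Rel
  rw [Role.inv_inv, or_comm]

theorem Rel.mono {R S : Role NR} {s t : T.Path} (h : Rel H R s t) (hRS : H.Sub R S) :
    Rel H S s t :=
  h.imp (fun ⟨y, h, Q, hQ, hQR⟩ => ⟨y, h, Q, hQ, hQR.trans hRS⟩)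
    (fun ⟨y, h, Q, hQ, hQR⟩ => ⟨y, h, Q, hQ, hQR.trans hRS.inv⟩)

end Path

/-- The unravelling of a complete and clash-free completion tree is a tableau. -/
theorem WellFormed.isTableau (hT : T.WellFormed H D) {ban : CTree NC NR → Node → ℕ}
    (hnon : ¬ ∃ T', T.NonGen H T') (hgen : ¬ ∃ T', T.Gen H ban T') (hcf : T.ClashFree H) :
    IsTableau H D T.Path Path.label (Path.Rel H) := by
  obtain ⟨h₁, h₂, h₃, h₄⟩ := hcf
  have hmem := fun s : T.Path => s.node_mem hT
  have hunb := fun s : T.Path => s.not_blocked_node hT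
  have hind := fun s : T.Path => not_indirectlyBlocked (hunb s)
  have hlab : ∀ {s : T.Path} {C}, C ∈ s.label → C ∈ T.label s.node := fun {s} _ h =>
    s.label_node.symm ▸ h
  refine
    { label_subset := fun s => hT.label_subset _
      root := ⟨⟨[[]], rfl⟩, hT.root_label⟩
      finite := fun s R _ => s.finite_rel hT R
      p1 := fun s C hC hn => h₁ ⟨_, hmem s, C, hlab hC, hlab hn⟩
      p2 := fun s C₁ C₂ h => ?_
      p3 := fun s C₁ C₂ h => ?_
      p4 := fun s t C R _ h hst => ?_
      p5 := fun s C R _ h => ?_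
      p6 := fun s t C R _ S _ h hst hRS hR => ?_
      p7 := fun s t R _ => Path.rel_inv R s t
      p8 := fun s t R _ S _ h hRS => h.mono hRS
      p9 := fun s C n R _ h => ?_
      p10 := fun s C n R _ h => ?_
      p11 := fun s C r R _ h => ?_
      p12 := fun s C r R _ h => ?_
      p13 := fun s t C F R _ hF h hst => ?_ }
  · by_contra hn
    rw [← s.label_node] at hn
    exact hnon ⟨_, .and (hmem s) (hlab h) (hind s) hn⟩
  · by_contra hn
    rw [← s.label_node, not_or] at hn
    exact hnon ⟨_, .or (hmem s) (hlab h) (hind s) hn.1 hn.2 (Or.inl rfl)⟩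
  · by_contra hn
    rw [← Path.label_nbr hst] at hn
    exact hnon ⟨_, .all (hmem s) (hlab h) (hind s) (Path.rNbr_nbr hT hst) hn⟩
  · by_contra hn
    obtain ⟨y, hy, hyT⟩ := T.exists_fresh_succ s.node
    refine hgen ⟨_, .ex (hmem s) (hlab h) (hunb s) ?_ hy hyT⟩
    rintro ⟨z, hz, hC⟩
    obtain ⟨t, ht, rfl⟩ := Path.exists_rel_of_rNbr hz
    exact hn ⟨t, ht, Path.label_nbr ht ▸ hC⟩
  · by_contra hn
    rw [← Path.label_nbr hst] at hn
    exact hnon ⟨_, .allPlus (hmem s) (hlab h) (hind s) hR hRS (Path.rNbr_nbr hT hst) hn⟩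
  · rw [s.ncard_rel_with hT]
    by_contra hn
    exact h₂ ⟨_, hmem s, n, R, C, hlab h, not_le.mp hn⟩
  · rw [s.ncard_rel_with hT]
    by_contra hn
    obtain ⟨y, hy, hyT⟩ := T.exists_fresh_succ s.node
    exact hgen ⟨_, .atLeast (hmem s) (hlab h) (hunb s) (not_le.mp hn) hy hyT⟩
  · rw [s.ncard_rel_with hT, s.ncard_rel hT]
    by_contra hn
    exact h₃ ⟨_, hmem s, r, R, C, hlab h, not_lt.mp hn⟩
  · rw [s.ncard_rel_with hT, s.ncard_rel hT]
    by_contra hn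
    exact h₄ ⟨_, hmem s, r, R, C, hlab h, not_le.mp hn⟩
  · by_contra hn
    rw [← Path.label_nbr hst, not_or] at hn
    exact hnon ⟨_, .choose (hmem s) hF (hlab h) (hind s) (Path.rNbr_nbr hT hst) hn.1 hn.2
      (Or.inl rfl)⟩

end CTree

end ALCQPIH

theorem mainTheorem5 {NC NR : Type*} [Nonempty NC] [Nonempty NR]
    (H : ALCQPIH.RBox NR) (Q₀ : Set ℚ) (hQ₀ : Q₀ ⊆ Set.Ioo 0 1)
    (ban : ALCQPIH.CTree NC NR → ALCQPIH.Node → ℕ)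
    (D : ALCQPIH.Concept NC NR) (hD : D.IsConcept H Q₀) (hnnf : D.IsNNF)
    (h : ∃ T : ALCQPIH.CTree NC NR,
      ALCQPIH.CTree.Yields H ban D T ∧ T.Complete H ban ∧ T.ClashFree H) :
    ALCQPIH.HasTableau H D := by
  obtain ⟨T, hY, hC, hcf⟩ := h
  rcases hC with ⟨hnon, hgen⟩ | hc | hc
  · exact ⟨_, _, _, hY.wellFormed.isTableau hnon hgen hcf⟩
  · exact (hcf.1 hc).elim
  · exact (hcf.2.1 hc).elim
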